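/- Let $(M,\omega=d\lambda)$ be an exact symplectic manifold (smooth, finite-dimensional, without boundary) and let $H\in C^\infty(M\times[0,1],\mathbb R)$; write $H_r=H(\cdot,r)$ for $r\in[0,1]$. Assume that for every $r\in[0,1]$ the number $0$ is a regular value of $H_r$ and the level set $H_r^{-1}(0)$ is connected, and that $H^{-1}(0)\subset M\times[0,1]$ is compact. Assume moreover that for every $r\in[0,1]$ the restriction $\lambda|_{H_r^{-1}(0)}$ is a contact form, and let $R_r$ be its Reeb vector field, i.e. the vector field on $H_r^{-1}(0)$ determined by $\lambda(R_r)=1$ and $d\lambda(R_r,v)=0$ for all $v$ tangent to $H_r^{-1}(0)$. Let $(\gamma_r,\tau_r)$, $r\in[0,1)$, be a smooth family of periodic Reeb orbits $\gamma_r$ with period $\tau_r$; that is, $\tau_r\in(0,\infty)$ depends smoothly on $r\in[0,1)$, the map $(r,t)\mapsto\gamma_r(t)\in M$ is smooth on $[0,1)\times\mathbb R/\mathbb Z$, and for all $r\in[0,1)$ the curve $\gamma_r$ lies in $H_r^{-1}(0)$ and satisfies $\partial_t\gamma_r=\tau_r R_r(\gamma_r)$. Then there exists $\tau_1\in(0,\infty)$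 such that $\tau_r\to\tau_1$ as $r\to1$, $r<1$. -/

import Mathlib

open Set Filter Topology
open scoped Manifold ContDiff Bundle

/-- The pointwise type of (not necessarily smooth) real-valued 1-forms on a manifold `M` without
boundary modelled on `E`. -/
abbrev OneForm (E : Type*) [NormedAddCommGroup E] [NormedSpace ℝ E] (M : Type*)
    [TopologicalSpace M] [ChartedSpace E M] : Type _ :=
  (x : M) → TangentSpace 𝓘(ℝ, E) x →L[ℝ] ℝ

section

variable {E : Type*} [NormedAddCommGroup E] [NormedSpace ℝ E]
variable {M : Type*} [TopologicalSpace M] [ChartedSpace E M]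

/-- A 1-form is smooth if it is a smooth section of the cotangent bundle. -/
def OneForm.IsSmooth [IsManifold 𝓘(ℝ, E) ∞ M] (lam : OneForm E M) : Prop :=
  ContMDiff 𝓘(ℝ, E) (𝓘(ℝ, E).prod 𝓘(ℝ, E →L[ℝ] ℝ)) ∞
    (fun x ↦ Bundle.TotalSpace.mk' (E →L[ℝ] ℝ)
      (E := fun x : M ↦ TangentSpace 𝓘(ℝ, E) x →L[ℝ] Bundle.Trivial M ℝ x) x (lam x))

/-- The 1-form `lam` in the preferred chart `φ` around `x₀`, i.e. the pullback
`(φ⁻¹)^* lam` as a 1-form on (the target of the chart in) `E`. -/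
noncomputable def OneForm.inChart (lam : OneForm E M) (x₀ : M) (y : E) : E →L[ℝ] ℝ :=
  (lam ((extChartAt 𝓘(ℝ, E) x₀).symm y)).comp
    (mfderiv 𝓘(ℝ, E) 𝓘(ℝ, E) (extChartAt 𝓘(ℝ, E) x₀).symm y)

/-- The exterior derivative `(d lam)_x (u, v)`, computed in the preferred chart `φ` around `x`:
it is `φ^* d ((φ⁻¹)^* lam)`. -/
noncomputable def OneForm.extD (lam : OneForm E M) (x : M) (u v : TangentSpace 𝓘(ℝ, E) x) : ℝ :=
  extDeriv
    (fun y : E ↦ ContinuousAlternatingMap.ofSubsingleton ℝ E ℝ (0 : Fin 1) (lam.inChart x y))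
    (extChartAt 𝓘(ℝ, E) x x)
    ![mfderiv 𝓘(ℝ, E) 𝓘(ℝ, E) (extChartAt 𝓘(ℝ, E) x) x u,
      mfderiv 𝓘(ℝ, E) 𝓘(ℝ, E) (extChartAt 𝓘(ℝ, E) x) x v]

/-- `(M, d lam)` is an exact symplectic manifold: `lam` is a smooth 1-form and the (automatically
closed) 2-form `d lam` is nondegenerate at every point. -/
structure IsExactSymplectic [IsManifold 𝓘(ℝ, E) ∞ M] (lam : OneForm E M) : Prop where
  smooth : lam.IsSmooth
  nondegenerate : ∀ (x : M) (u : TangentSpace 𝓘(ℝ, E) x), (∀ v, lam.extD x u v = 0) → u = 0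

/-- `0` is a regular value of `h`. -/
def ZeroIsRegularValue (h : M → ℝ) : Prop :=
  ∀ x : M, h x = 0 → Function.Surjective (mvfderiv 𝓘(ℝ, E) h x)

/-- The tangent space at `x` of the level set of `h` through the regular point `x`, that is
`ker (dh)_x`. -/
noncomputable def levelTangent (h : M → ℝ) (x : M) : Submodule ℝ (TangentSpace 𝓘(ℝ, E) x) :=
  LinearMap.ker (mvfderiv 𝓘(ℝ, E) h x : TangentSpace 𝓘(ℝ, E) x →ₗ[ℝ] ℝ)

/-- The restriction `α` of `lam` to the regular level set `Σ = h⁻¹(0)` is a contact form: at each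
point, `α` is nonzero on `TΣ`, and `dα = (d lam)|_{TΣ}` is nondegenerate on `ker α ⊆ TΣ`. -/
def IsContactOnZeroSet (lam : OneForm E M) (h : M → ℝ) : Prop :=
  ∀ x : M, h x = 0 →
    (∃ v ∈ levelTangent h x, lam x v ≠ 0) ∧
    ∀ u ∈ levelTangent h x, lam x u = 0 →
      (∀ v ∈ levelTangent h x, lam x v = 0 → lam.extD x u v = 0) → u = 0

/-- `R` is the value at `x ∈ Σ = h⁻¹(0)` of the Reeb vector field of the contact form
`α = lam|_Σ`: it is tangent to `Σ`, `α(R) = 1`, and `dα(R, ·) = 0` on `TΣ`. -/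
structure IsReebVector (lam : OneForm E M) (h : M → ℝ) (x : M)
    (R : TangentSpace 𝓘(ℝ, E) x) : Prop where
  mem_zeroSet : h x = 0
  tangent : R ∈ levelTangent h x
  normalized : lam x R = 1
  kernel : ∀ v ∈ levelTangent h x, lam.extD x R v = 0

/-- A smooth family `(γ_r, τ_r)`, `r ∈ [0,1)`, of periodic Reeb orbits on the level sets
`H_r⁻¹(0)`. The orbit `γ_r` of period `τ_r > 0` is parametrized over `S¹ = ℝ/ℤ`, that is as a
`1`-periodic curve with `∂_t γ_r = τ_r R_r(γ_r)`, where `R_r` is the Reeb vector field. -/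
structure IsPeriodicReebFamily (lam : OneForm E M) (H : ℝ → M → ℝ)
    (γ : ℝ → ℝ → M) (τ : ℝ → ℝ) : Prop where
  smooth_orbit : ContMDiffOn 𝓘(ℝ, ℝ × ℝ) 𝓘(ℝ, E) ∞ (fun p : ℝ × ℝ ↦ γ p.1 p.2)
    (Ico (0 : ℝ) 1 ×ˢ univ)
  smooth_period : ContDiffOn ℝ ∞ τ (Ico 0 1)
  period_pos : ∀ r ∈ Ico (0 : ℝ) 1, 0 < τ r
  periodic : ∀ r ∈ Ico (0 : ℝ) 1, Function.Periodic (γ r) 1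
  velocity : ∀ r ∈ Ico (0 : ℝ) 1, ∀ t : ℝ,
    ∃ R : TangentSpace 𝓘(ℝ, E) (γ r t), IsReebVector lam (H r) (γ r t) R ∧
      HasMFDerivAt 𝓘(ℝ, ℝ) 𝓘(ℝ, E) (γ r) t
        ((1 : ℝ →L[ℝ] ℝ).smulRight (τ r • R))

end

/-!
Write `λ` for the 1-form and `Γ (r, t) = γ_r t`. Since `λ (∂_t Γ) = τ_r`, we have
`∂_r τ = dλ (∂_r Γ, ∂_t Γ) + ∂_t (λ (∂_r Γ))`, and `λ (∂_r Γ)` is `1`-periodic in `t`, so by Rolle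
`∂_r τ = dλ (∂_r Γ, ∂_t Γ)` for some `t`. Along the level sets `dλ (R_r, ·) = c dH_r`, while
differentiating `H_r (γ_r t) = 0` in `r` gives `dH_r (∂_r Γ) = -∂_r H`; hence `∂_r τ = τ c ∂_r H`.
The pair `(R_r, c)` solves an injective linear system depending continuously on the point, so `c`
is locally bounded. By compactness of the zero set `|∂_r τ| ≤ C τ`, that is, `log τ` is Lipschitz.
-/

section LinearAlgebra

lemma exists_eventually_nhds_antilipschitzWith {𝕜 F G : Type*} [NontriviallyNormedField 𝕜]
    [CompleteSpace 𝕜] [NormedAddCommGroup F] [NormedSpace 𝕜 F] [FiniteDimensional 𝕜 F]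
    [NormedAddCommGroup G] [NormedSpace 𝕜 G] {L₀ : F →L[𝕜] G} (hL₀ : Function.Injective L₀) :
    ∃ K, ∀ᶠ L : F →L[𝕜] G in 𝓝 L₀, AntilipschitzWith K L := by
  obtain ⟨K, hK, hL₀K⟩ := L₀.injective_iff_antilipschitz.1 hL₀
  have hhalf : K⁻¹ / 2 < K⁻¹ := half_lt_self (inv_pos_of_pos hK)
  refine ⟨(K⁻¹ - K⁻¹ / 2)⁻¹, ?_⟩
  filter_upwards [eventually_nnnorm_sub_lt L₀ (half_pos (inv_pos_of_pos hK))] with L hL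
  exact hL₀K.add_sub_lipschitzWith ((L - L₀).lipschitz.weaken hL.le) hhalf

lemma exists_eq_smul_of_ker_le_ker {𝕜 V : Type*} [Field 𝕜] [AddCommGroup V] [Module 𝕜 V]
    {f g : V →ₗ[𝕜] 𝕜} (h : LinearMap.ker f ≤ LinearMap.ker g) : ∃ c : 𝕜, g = c • f := by
  have hg : g ∈ Submodule.span 𝕜 (range fun _ : Unit ↦ f) :=
    mem_span_of_iInf_ker_le_ker (by simpa only [iInf_const] using h)
  rw [range_const, Submodule.mem_span_singleton] at hg
  exact hg.imp fun c hc ↦ hc.symm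

variable {E : Type*} [NormedAddCommGroup E] [NormedSpace ℝ E]

/-- The linear system `(u, c) ↦ (B u - c β, β u, α u)`. Its solutions with right-hand side
`(0, 0, 1)` are the pairs of a Reeb vector `u` of the restriction of `(α, B)` to `ker β` and the
multiplier `c` with `B u = c β`. -/
noncomputable def reebSystem (D : (E →L[ℝ] ℝ) × (E →L[ℝ] ℝ) × (E →L[ℝ] E →L[ℝ] ℝ)) :
    E × ℝ →L[ℝ] (E →L[ℝ] ℝ) × ℝ × ℝ :=
  (D.2.2.comp (.fst ℝ E ℝ) - (ContinuousLinearMap.snd ℝ E ℝ).smulRight D.2.1).prod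
    ((D.2.1.comp (.fst ℝ E ℝ)).prod (D.1.comp (.fst ℝ E ℝ)))

lemma reebSystem_apply (α β : E →L[ℝ] ℝ) (B : E →L[ℝ] E →L[ℝ] ℝ) (u : E) (c : ℝ) :
    reebSystem (α, β, B) (u, c) = (B u - c • β, β u, α u) := rfl

lemma continuous_reebSystem [FiniteDimensional ℝ E] : Continuous (reebSystem (E := E)) := by
  rw [continuous_clm_apply]
  rintro ⟨u, c⟩
  change Continuous fun D : (E →L[ℝ] ℝ) × (E →L[ℝ] ℝ) × (E →L[ℝ] E →L[ℝ] ℝ) ↦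
    (D.2.2 u - c • D.2.1, D.2.1 u, D.1 u)
  fun_prop

lemma injective_reebSystem {α β : E →L[ℝ] ℝ} {B : E →L[ℝ] E →L[ℝ] ℝ} (hβ : β ≠ 0)
    (hcontact : ∀ u, β u = 0 → α u = 0 → (∀ v, β v = 0 → B u v = 0) → u = 0) :
    Function.Injective (reebSystem (α, β, B)) := by
  refine (injective_iff_map_eq_zero _).2 ?_
  rintro ⟨u, c⟩ huc
  simp only [reebSystem_apply, Prod.mk_eq_zero, sub_eq_zero] at huc
  obtain ⟨hB, hβu, hαu⟩ := huc
  have hu : u = 0 := hcontact u hβu hαu fun v hv ↦ by simp [hB, hv]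
  have hc : c • β = 0 := by rw [← hB, hu, map_zero]
  simp [hu, (smul_eq_zero.1 hc).resolve_right hβ]

lemma exists_eventually_abs_reebMultiplier_le [FiniteDimensional ℝ E] {α₀ β₀ : E →L[ℝ] ℝ}
    {B₀ : E →L[ℝ] E →L[ℝ] ℝ} (hβ₀ : β₀ ≠ 0)
    (hcontact : ∀ u, β₀ u = 0 → α₀ u = 0 → (∀ v, β₀ v = 0 → B₀ u v = 0) → u = 0) :
    ∃ C : ℝ, ∀ᶠ D in 𝓝 (α₀, β₀, B₀), ∀ R c, D.1 R = 1 → D.2.1 R = 0 → D.2.2 R = c • D.2.1 →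
      |c| ≤ C := by
  obtain ⟨K, hK⟩ := exists_eventually_nhds_antilipschitzWith (injective_reebSystem hβ₀ hcontact)
  refine ⟨K, (continuous_reebSystem.continuousAt.eventually hK).mono ?_⟩
  rintro ⟨α, β, B⟩ hanti R c (hα : α R = 1) (hβ : β R = 0) (hB : B R = c • β)
  have hsol : reebSystem (α, β, B) (R, c) = (0, 0, 1) := by
    rw [reebSystem_apply, hα, hβ, hB, sub_self]
  calc |c| ≤ ‖(R, c)‖ := norm_snd_le (R, c)
    _ ≤ K * ‖reebSystem (α, β, B) (R, c)‖ := ZeroHomClass.bound_of_antilipschitz _ hanti _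
    _ = K := by simp [hsol]

end LinearAlgebra

lemma exists_forall_mem_of_isCompact {X : Type*} [TopologicalSpace X] {K : Set X}
    (hK : IsCompact K) {P : X → ℝ → Prop} (hmono : ∀ x C C', P x C → C ≤ C' → P x C')
    (hloc : ∀ x ∈ K, ∃ C, ∀ᶠ z in 𝓝[K] x, P z C) : ∃ C, ∀ x ∈ K, P x C := by
  refine hK.induction_on (p := fun s ↦ ∃ C, ∀ x ∈ s, P x C) ⟨0, by simp⟩
    (fun _ _ hst ⟨C, hC⟩ ↦ ⟨C, fun x hx ↦ hC x (hst hx)⟩) ?_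
    fun x hx ↦ (hloc x hx).elim fun C hC ↦ ⟨_, hC, C, fun _ hz ↦ hz⟩
  rintro s t ⟨C, hC⟩ ⟨C', hC'⟩
  refine ⟨max C C', ?_⟩
  rintro x (hx | hx)
  · exact hmono x _ _ (hC x hx) (le_max_left C C')
  · exact hmono x _ _ (hC' x hx) (le_max_right C C')

lemma exists_tendsto_nhdsLT_of_abs_deriv_le_mul {f : ℝ → ℝ} {a b C : ℝ} (hab : a < b)
    (hpos : ∀ r ∈ Ioo a b, 0 < f r) (hdiff : ∀ r ∈ Ioo a b, DifferentiableAt ℝ f r)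
    (hderiv : ∀ r ∈ Ioo a b, |deriv f r| ≤ C * f r) :
    ∃ l : ℝ, 0 < l ∧ Tendsto f (𝓝[<] b) (𝓝 l) := by
  have hlog : LipschitzOnWith C.toNNReal (fun r ↦ Real.log (f r)) (Ioo a b) := by
    refine (convex_Ioo a b).lipschitzOnWith_of_nnnorm_hasDerivWithin_le
      (fun r hr ↦ ((hdiff r hr).hasDerivAt.log (hpos r hr).ne').hasDerivWithinAt) fun r hr ↦ ?_
    rw [← NNReal.coe_le_coe, coe_nnnorm, Real.norm_eq_abs, abs_div, abs_of_pos (hpos r hr)]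
    exact ((div_le_iff₀ (hpos r hr)).2 (hderiv r hr)).trans (Real.le_coe_toNNReal C)
  obtain ⟨g, hg, hgf⟩ := hlog.extend_real
  have hexp : Tendsto (fun r ↦ Real.exp (g r)) (𝓝[<] b) (𝓝 (Real.exp (g b))) :=
    ((Real.continuous_exp.comp hg.continuous).tendsto b).mono_left nhdsWithin_le_nhds
  refine ⟨Real.exp (g b), Real.exp_pos _, hexp.congr' ?_⟩
  filter_upwards [Ioo_mem_nhdsLT hab] with r hr
  rw [← hgf hr, Real.exp_log (hpos r hr)]

section ExteriorDerivative

variable {P E F : Type*} [NormedAddCommGroup P] [NormedSpace ℝ P]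
  [NormedAddCommGroup E] [NormedSpace ℝ E] [NormedAddCommGroup F] [NormedSpace ℝ F]

/-- The exterior derivative of a 1-form on a normed space, as a bilinear map. For 1-forms this
spares the alternating maps of Mathlib's `extDeriv`. -/
noncomputable def oneFormExtDeriv (A : E → E →L[ℝ] F) (y : E) : E →L[ℝ] E →L[ℝ] F :=
  fderiv ℝ A y - (fderiv ℝ A y).flip

lemma oneFormExtDeriv_apply (A : E → E →L[ℝ] F) (y u v : E) :
    oneFormExtDeriv A y u v = fderiv ℝ A y u v - fderiv ℝ A y v u := rfl

lemma oneFormExtDeriv_congr {A A' : E → E →L[ℝ] F} {y : E} (h : A =ᶠ[𝓝 y] A') :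
    oneFormExtDeriv A y = oneFormExtDeriv A' y := by
  rw [oneFormExtDeriv, oneFormExtDeriv, h.fderiv_eq]

lemma continuousAt_oneFormExtDeriv {A : E → E →L[ℝ] F} {y : E} (hA : ContDiffAt ℝ 1 A y) :
    ContinuousAt (oneFormExtDeriv A) y := by
  -- Instance search for this class times out on iterated spaces of continuous linear maps.
  have : ContinuousSub (E →L[ℝ] E →L[ℝ] F) := IsTopologicalAddGroup.to_continuousSub
  have hskew : Continuous fun B : E →L[ℝ] E →L[ℝ] F ↦ B - B.flip :=
    continuous_id.sub (ContinuousLinearMap.flipₗᵢ ℝ E E F).continuous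
  exact hskew.continuousAt.comp (hA.fderiv_right (m := 0) (by simp)).continuousAt

lemma extDeriv_ofSubsingleton_apply {A : E → E →L[ℝ] F} {y : E} (hA : DifferentiableAt ℝ A y)
    (u v : E) :
    extDeriv (fun y ↦ ContinuousAlternatingMap.ofSubsingleton ℝ E F (0 : Fin 1) (A y)) y ![u, v] =
      oneFormExtDeriv A y u v := by
  have hω : DifferentiableAt ℝ
      (fun y ↦ ContinuousAlternatingMap.ofSubsingleton ℝ E F (0 : Fin 1) (A y)) y :=
    (ContinuousAlternatingMap.ofSubsingletonLIE (𝕜 := ℝ) (E := E) (F := F)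
      (0 : Fin 1)).differentiable.differentiableAt.comp y hA
  have hflip (w : E) : fderiv ℝ (fun y ↦ A y w) y = (fderiv ℝ A y).flip w := by
    ext z
    simp [fderiv_clm_apply hA (differentiableAt_const w)]
  simp [extDeriv_apply hω, Fin.sum_univ_two, Fin.removeNth, hflip, oneFormExtDeriv_apply,
    sub_eq_add_neg]

lemma hasFDerivAt_comp_fderiv {A : E → E →L[ℝ] F} {Γ : P → E} {q : P}
    (hΓ : ContDiffAt ℝ 2 Γ q) (hA : DifferentiableAt ℝ A (Γ q)) :
    ∃ L : P →L[ℝ] P →L[ℝ] F, HasFDerivAt (fun z ↦ (A (Γ z)).comp (fderiv ℝ Γ z)) L q ∧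
      ∀ a b, L a b = fderiv ℝ A (Γ q) (fderiv ℝ Γ q a) (fderiv ℝ Γ q b) +
        A (Γ q) (fderiv ℝ (fderiv ℝ Γ) q a b) := by
  have hDΓ : DifferentiableAt ℝ (fderiv ℝ Γ) q :=
    (hΓ.fderiv_right (m := 1) (by norm_num)).differentiableAt (by simp)
  have hAΓ := hA.hasFDerivAt.comp q (hΓ.differentiableAt (by simp)).hasFDerivAt
  exact ⟨_, hAΓ.clm_comp hDΓ.hasFDerivAt, fun a b ↦ by simp [add_comm]⟩

lemma oneFormExtDeriv_comp_fderiv {A : E → E →L[ℝ] F} {Γ : P → E} {q : P}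
    (hΓ : ContDiffAt ℝ 2 Γ q) (hA : DifferentiableAt ℝ A (Γ q)) (a b : P) :
    oneFormExtDeriv (fun z ↦ (A (Γ z)).comp (fderiv ℝ Γ z)) q a b =
      oneFormExtDeriv A (Γ q) (fderiv ℝ Γ q a) (fderiv ℝ Γ q b) := by
  obtain ⟨L, hL, hLab⟩ := hasFDerivAt_comp_fderiv hΓ hA
  have hsymm : fderiv ℝ (fderiv ℝ Γ) q a b = fderiv ℝ (fderiv ℝ Γ) q b a :=
    hΓ.isSymmSndFDerivAt (by simp) a b
  rw [oneFormExtDeriv_apply, oneFormExtDeriv_apply, hL.fderiv, hLab, hLab, hsymm,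
    add_sub_add_right_eq_sub]

end ExteriorDerivative

lemma exists_oneFormExtDeriv_eq_deriv {A : ℝ × ℝ → ℝ × ℝ →L[ℝ] ℝ} {f : ℝ → ℝ} {r a b : ℝ}
    (hab : a < b) (hA : ∀ t, DifferentiableAt ℝ A (r, t))
    (hf : ∀ t, ∀ᶠ s in 𝓝 r, A (s, t) (0, 1) = f s) (hends : A (r, a) (1, 0) = A (r, b) (1, 0)) :
    ∃ t, oneFormExtDeriv A (r, t) (1, 0) (0, 1) = deriv f r := by
  have happly (t : ℝ) (v : ℝ × ℝ) :
      HasFDerivAt (fun q ↦ A q v) ((fderiv ℝ A (r, t)).flip v) (r, t) :=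
    (ContinuousLinearMap.apply ℝ ℝ v).hasFDerivAt.comp (r, t) (hA t).hasFDerivAt
  have hr (t : ℝ) : HasDerivAt f (fderiv ℝ A (r, t) (1, 0) (0, 1)) r :=
    ((happly t (0, 1)).comp_hasDerivAt_of_eq r ((hasDerivAt_id r).prodMk (hasDerivAt_const r t))
      rfl).congr_of_eventuallyEq ((hf t).mono fun _ hs ↦ hs.symm)
  have ht (t : ℝ) : HasDerivAt (fun t ↦ A (r, t) (1, 0)) (fderiv ℝ A (r, t) (0, 1) (1, 0)) t :=
    (happly t (1, 0)).comp_hasDerivAt_of_eq t ((hasDerivAt_const t r).prodMk (hasDerivAt_id t)) rfl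
  obtain ⟨t, -, hzero⟩ := exists_hasDerivAt_eq_zero hab
    (fun t _ ↦ (ht t).continuousAt.continuousWithinAt) hends fun t _ ↦ ht t
  exact ⟨t, by rw [oneFormExtDeriv_apply, hzero, sub_zero, (hr t).deriv]⟩

section PartialDerivatives

variable {E G F : Type*} [NormedAddCommGroup E] [NormedSpace ℝ E]
  [NormedAddCommGroup G] [NormedSpace ℝ G] [NormedAddCommGroup F] [NormedSpace ℝ F]

lemma continuousOn_fderiv_prodMk_left {f : E × G → F} {U : Set E} {S : Set G} (hU : IsOpen U)
    (hS : UniqueDiffOn ℝ S) (hf : ContDiffOn ℝ 1 f (U ×ˢ S)) :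
    ContinuousOn (fun q : E × G ↦ fderiv ℝ (fun y ↦ f (y, q.2)) q.1) (U ×ˢ S) := by
  have hDf : ContinuousOn (fderivWithin ℝ f (U ×ˢ S)) (U ×ˢ S) :=
    hf.continuousOn_fderivWithin (hU.uniqueDiffOn.prod hS) le_rfl
  refine (hDf.clm_comp (continuousOn_const (c := .inl ℝ E G))).congr ?_
  rintro ⟨y, s⟩ hq
  have hfq := (hf.differentiableOn one_ne_zero (y, s) hq).hasFDerivWithinAt
  have hfy := hfq.comp y (hasFDerivAt_prodMk_left y s).hasFDerivWithinAt
    fun _ hz ↦ mk_mem_prod hz hq.2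
  exact (hfy.hasFDerivAt (hU.mem_nhds hq.1)).fderiv

lemma continuousOn_derivWithin_prodMk_right {f : E × ℝ → F} {U : Set E} {S : Set ℝ}
    (hU : IsOpen U) (hS : UniqueDiffOn ℝ S) (hf : ContDiffOn ℝ 1 f (U ×ˢ S)) :
    ContinuousOn (fun q : E × ℝ ↦ derivWithin (fun s ↦ f (q.1, s)) S q.2) (U ×ˢ S) := by
  have hDf : ContinuousOn (fderivWithin ℝ f (U ×ˢ S)) (U ×ˢ S) :=
    hf.continuousOn_fderivWithin (hU.uniqueDiffOn.prod hS) le_rfl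
  refine (hDf.clm_apply (continuousOn_const (c := ((0, 1) : E × ℝ)))).congr ?_
  rintro ⟨y, s⟩ hq
  have hfq := (hf.differentiableOn one_ne_zero (y, s) hq).hasFDerivWithinAt
  have hfs := hfq.comp s (hasFDerivAt_prodMk_right (𝕜 := ℝ) y s).hasFDerivWithinAt
    fun _ hz ↦ mk_mem_prod hq.1 hz
  simpa [Function.comp_def] using hfs.hasDerivWithinAt.derivWithin (hS s hq.2)

end PartialDerivatives

section Pullback

variable {E : Type*} [NormedAddCommGroup E] [NormedSpace ℝ E]
variable {M : Type*} [TopologicalSpace M] [ChartedSpace E M]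
variable {P Q : Type*} [NormedAddCommGroup P] [NormedSpace ℝ P]
  [NormedAddCommGroup Q] [NormedSpace ℝ Q]

namespace OneForm

/-- The pullback `g^* lam` of a 1-form along a map from a normed space, as a 1-form on that
space. -/
noncomputable def pullback (lam : OneForm E M) (g : P → M) (q : P) : P →L[ℝ] ℝ :=
  (lam (g q)).comp (mfderiv 𝓘(ℝ, P) 𝓘(ℝ, E) g q)

lemma extD_smul_left (lam : OneForm E M) (x : M) (c : ℝ) (u v : TangentSpace 𝓘(ℝ, E) x) :
    lam.extD x (c • u) v = c * lam.extD x u v := by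
  rw [extD, ContinuousLinearMap.map_smul]
  exact ContinuousAlternatingMap.vecCons_smul _ _ _ _

lemma inChart_eq_pullback (lam : OneForm E M) (x₀ : M) :
    lam.inChart x₀ = lam.pullback (extChartAt 𝓘(ℝ, E) x₀).symm := rfl

lemma pullback_congr (lam : OneForm E M) {g g' : P → M} {q : P} (h : g =ᶠ[𝓝 q] g') :
    lam.pullback g q = lam.pullback g' q := by
  have hlam : (show E →L[ℝ] ℝ from lam (g q)) = lam (g' q) := by rw [h.eq_of_nhds]
  exact congrArg₂ (fun (L : E →L[ℝ] ℝ) (D : P →L[ℝ] E) ↦ L.comp D) hlam h.mfderiv_eq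

lemma pullback_comp (lam : OneForm E M) {g : Q → M} {f : P → Q} {q : P}
    (hf : DifferentiableAt ℝ f q) (hg : MDifferentiableAt 𝓘(ℝ, Q) 𝓘(ℝ, E) g (f q)) :
    lam.pullback (g ∘ f) q = (lam.pullback g (f q)).comp (fderiv ℝ f q) := by
  rw [pullback, mfderiv_comp q hg hf.mdifferentiableAt, mfderiv_eq_fderiv]
  rfl

lemma inChart_extChartAt (lam : OneForm E M) {x₀ x : M}
    (hx : x ∈ (extChartAt 𝓘(ℝ, E) x₀).source) :
    lam.inChart x₀ (extChartAt 𝓘(ℝ, E) x₀ x) =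
      (lam x).comp (mfderiv 𝓘(ℝ, E) 𝓘(ℝ, E) (extChartAt 𝓘(ℝ, E) x₀).symm
        (extChartAt 𝓘(ℝ, E) x₀ x)) :=
  congrArg (fun z ↦ (lam z : E →L[ℝ] ℝ).comp (mfderiv 𝓘(ℝ, E) 𝓘(ℝ, E)
    (extChartAt 𝓘(ℝ, E) x₀).symm (extChartAt 𝓘(ℝ, E) x₀ x))) ((extChartAt 𝓘(ℝ, E) x₀).left_inv hx)

end OneForm

variable [IsManifold 𝓘(ℝ, E) ∞ M]

lemma contMDiffAt_extChartAt_symm {x₀ : M} {y : E} (hy : y ∈ (extChartAt 𝓘(ℝ, E) x₀).target) :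
    ContMDiffAt 𝓘(ℝ, E) 𝓘(ℝ, E) ∞ (extChartAt 𝓘(ℝ, E) x₀).symm y :=
  (contMDiffOn_extChartAt_symm x₀).contMDiffAt (extChartAt_target_mem_nhds' hy)

lemma contDiffAt_extChartAt_comp {x₀ : M} {g : P → M} {q : P} {n : ℕ∞ω} (hn : n ≤ ∞)
    (hg : ContMDiffAt 𝓘(ℝ, P) 𝓘(ℝ, E) n g q) (hq : g q ∈ (extChartAt 𝓘(ℝ, E) x₀).source) :
    ContDiffAt ℝ n (fun z ↦ extChartAt 𝓘(ℝ, E) x₀ (g z)) q := by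
  rw [extChartAt_source] at hq
  exact contMDiffAt_iff_contDiffAt.1 (((contMDiffAt_extChartAt' hq).of_le hn).comp q hg)

lemma fderiv_extChartAt_comp {x₀ : M} {g : P → M} {q : P}
    (hg : MDifferentiableAt 𝓘(ℝ, P) 𝓘(ℝ, E) g q) (hq : g q ∈ (extChartAt 𝓘(ℝ, E) x₀).source)
    (a : P) :
    fderiv ℝ (fun z ↦ extChartAt 𝓘(ℝ, E) x₀ (g z)) q a =
      mfderiv 𝓘(ℝ, E) 𝓘(ℝ, E) (extChartAt 𝓘(ℝ, E) x₀) (g q)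
        (mfderiv 𝓘(ℝ, P) 𝓘(ℝ, E) g q a) := by
  rw [extChartAt_source] at hq
  have h := mfderiv_comp q (mdifferentiableAt_extChartAt hq) hg
  rw [mfderiv_eq_fderiv] at h
  exact DFunLike.congr_fun h a

namespace OneForm

lemma pullback_eventuallyEq_comp_fderiv (lam : OneForm E M) {x₀ : M} {g : P → M} {q : P}
    (hg : ContMDiffAt 𝓘(ℝ, P) 𝓘(ℝ, E) 1 g q) (hq : g q ∈ (extChartAt 𝓘(ℝ, E) x₀).source) :
    lam.pullback g =ᶠ[𝓝 q] fun z ↦ (lam.inChart x₀ (extChartAt 𝓘(ℝ, E) x₀ (g z))).comp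
      (fderiv ℝ (fun z ↦ extChartAt 𝓘(ℝ, E) x₀ (g z)) z) := by
  have hΓ : ContDiffAt ℝ 1 (fun z ↦ extChartAt 𝓘(ℝ, E) x₀ (g z)) q :=
    contDiffAt_extChartAt_comp (by simp) hg hq
  have hsource : ∀ᶠ z in 𝓝 q, g z ∈ (extChartAt 𝓘(ℝ, E) x₀).source :=
    hg.continuousAt.eventually (extChartAt_source_mem_nhds' hq)
  filter_upwards [hsource.eventually_nhds, hΓ.eventually (by simp)] with z hz hΓz
  have hg_eq : g =ᶠ[𝓝 z]
      (extChartAt 𝓘(ℝ, E) x₀).symm ∘ fun z ↦ extChartAt 𝓘(ℝ, E) x₀ (g z) :=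
    hz.mono fun w hw ↦ ((extChartAt 𝓘(ℝ, E) x₀).left_inv hw).symm
  have htarget : extChartAt 𝓘(ℝ, E) x₀ (g z) ∈ (extChartAt 𝓘(ℝ, E) x₀).target :=
    (extChartAt 𝓘(ℝ, E) x₀).map_source hz.self_of_nhds
  rw [lam.pullback_congr hg_eq, lam.pullback_comp (hΓz.differentiableAt (by simp))
    ((contMDiffAt_extChartAt_symm htarget).mdifferentiableAt (by simp)), inChart_eq_pullback]

lemma IsSmooth.contDiffAt_inChart {lam : OneForm E M} (hlam : lam.IsSmooth) (x₀ : M) :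
    ContDiffAt ℝ ∞ (lam.inChart x₀) (extChartAt 𝓘(ℝ, E) x₀ x₀) := by
  have hcomp : ContMDiffAt 𝓘(ℝ, E) 𝓘(ℝ, E →L[ℝ] ℝ) ∞
      (fun x ↦ lam.inChart x₀ (extChartAt 𝓘(ℝ, E) x₀ x)) x₀ := by
    refine ((contMDiffAt_hom_bundle _).1 (hlam x₀)).2.congr_of_eventuallyEq ?_
    filter_upwards [extChartAt_source_mem_nhds (I := 𝓘(ℝ, E)) x₀] with x hx
    have hsymm := TangentBundle.symmL_trivializationAt (I := 𝓘(ℝ, E)) (𝕜 := ℝ)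
      (by rwa [extChartAt_source] at hx)
    rw [modelWithCornersSelf_coe, range_id, mfderivWithin_univ] at hsymm
    rw [lam.inChart_extChartAt hx, ContinuousLinearMap.inCoordinates, hsymm]
    ext v
    exact (DFunLike.congr_fun
      (Bundle.Trivial.continuousLinearMapAt_trivialization ℝ M ℝ x) _).symm
  refine (contMDiffAt_iff_contDiffAt.1 <| (hcomp.comp_of_eq
    (contMDiffAt_extChartAt_symm (mem_extChartAt_target x₀))
    (extChartAt_to_inv x₀))).congr_of_eventuallyEq ?_
  filter_upwards [extChartAt_target_mem_nhds (I := 𝓘(ℝ, E)) x₀] with y hy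
  rw [Function.comp_apply, (extChartAt 𝓘(ℝ, E) x₀).right_inv hy]

lemma IsSmooth.differentiableAt_inChart {lam : OneForm E M} (hlam : lam.IsSmooth) (x₀ : M) :
    DifferentiableAt ℝ (lam.inChart x₀) (extChartAt 𝓘(ℝ, E) x₀ x₀) :=
  (hlam.contDiffAt_inChart x₀).differentiableAt (by simp)

lemma IsSmooth.differentiableAt_pullback {lam : OneForm E M} (hlam : lam.IsSmooth) {g : P → M}
    {q : P} (hg : ContMDiffAt 𝓘(ℝ, P) 𝓘(ℝ, E) 2 g q) :
    DifferentiableAt ℝ (lam.pullback g) q := by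
  have hsource := mem_extChartAt_source (I := 𝓘(ℝ, E)) (g q)
  have hΓ := contDiffAt_extChartAt_comp ENat.LEInfty.out hg hsource
  obtain ⟨L, hL, -⟩ := hasFDerivAt_comp_fderiv hΓ (hlam.differentiableAt_inChart (g q))
  exact hL.differentiableAt.congr_of_eventuallyEq
    (lam.pullback_eventuallyEq_comp_fderiv (hg.of_le one_le_two) hsource)

lemma IsSmooth.oneFormExtDeriv_pullback {lam : OneForm E M} (hlam : lam.IsSmooth) {g : P → M}
    {q : P} (hg : ContMDiffAt 𝓘(ℝ, P) 𝓘(ℝ, E) 2 g q) (a b : P) :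
    oneFormExtDeriv (lam.pullback g) q a b =
      lam.extD (g q) (mfderiv 𝓘(ℝ, P) 𝓘(ℝ, E) g q a) (mfderiv 𝓘(ℝ, P) 𝓘(ℝ, E) g q b) := by
  have hsource := mem_extChartAt_source (I := 𝓘(ℝ, E)) (g q)
  have hΓ := contDiffAt_extChartAt_comp ENat.LEInfty.out hg hsource
  have hg' := hg.mdifferentiableAt (by simp)
  rw [oneFormExtDeriv_congr
      (lam.pullback_eventuallyEq_comp_fderiv (hg.of_le one_le_two) hsource),
    oneFormExtDeriv_comp_fderiv hΓ (hlam.differentiableAt_inChart (g q)),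
    fderiv_extChartAt_comp hg' hsource, fderiv_extChartAt_comp hg' hsource]
  exact (extDeriv_ofSubsingleton_apply (hlam.differentiableAt_inChart (g q)) _ _).symm

end OneForm

end Pullback

section Families

variable {E : Type*} [NormedAddCommGroup E] [NormedSpace ℝ E]
variable {M : Type*} [TopologicalSpace M] [ChartedSpace E M]
variable {H : ℝ → M → ℝ} {S : Set ℝ}

lemma tendsto_extChartAt_prod (x₀ : M) {r₀ : ℝ} (S : Set ℝ) :
    Tendsto (fun p : M × ℝ ↦ (extChartAt 𝓘(ℝ, E) x₀ p.1, p.2)) (𝓝[univ ×ˢ S] (x₀, r₀))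
      (𝓝[(extChartAt 𝓘(ℝ, E) x₀).target ×ˢ S] (extChartAt 𝓘(ℝ, E) x₀ x₀, r₀)) := by
  rw [nhdsWithin_prod_eq, nhdsWithin_prod_eq, nhdsWithin_univ,
    (isOpen_extChartAt_target x₀).nhdsWithin_eq (mem_extChartAt_target x₀)]
  exact (continuousAt_extChartAt x₀).tendsto.prodMap tendsto_id

lemma contMDiff_of_family
    (hH : ContMDiffOn (𝓘(ℝ, E).prod 𝓘(ℝ, ℝ)) 𝓘(ℝ, ℝ) 1 (fun p : M × ℝ ↦ H p.2 p.1)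
      (univ ×ˢ S)) {r : ℝ} (hr : r ∈ S) : ContMDiff 𝓘(ℝ, E) 𝓘(ℝ, ℝ) 1 (H r) :=
  contMDiffOn_univ.1 <| hH.comp (f := fun x ↦ (x, r))
    (contMDiff_id.prodMk contMDiff_const).contMDiffOn fun _ _ ↦ ⟨mem_univ _, hr⟩

lemma hasDerivAt_family_comp {r : ℝ} {c : ℝ → M} {L : ℝ →L[ℝ] TangentSpace 𝓘(ℝ, E) (c r)}
    (hH : MDifferentiableAt (𝓘(ℝ, E).prod 𝓘(ℝ, ℝ)) 𝓘(ℝ, ℝ) (fun p : M × ℝ ↦ H p.2 p.1) (c r, r))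
    (hc : HasMFDerivAt 𝓘(ℝ, ℝ) 𝓘(ℝ, E) c r L) :
    HasDerivAt (fun s ↦ H s (c s))
      (mvfderiv 𝓘(ℝ, E) (H r) (c r) (L 1) + deriv (fun s ↦ H s (c r)) r) r := by
  have hcomp : HasMFDerivAt 𝓘(ℝ, ℝ) 𝓘(ℝ, ℝ) (fun s ↦ H s (c s)) r _ :=
    HasMFDerivAt.comp (f := fun s ↦ (c s, s)) r hH.hasMFDerivAt (hc.prodMk (hasMFDerivAt_id r))
  have hfderiv : HasFDerivAt (𝕜 := ℝ) (E := ℝ) (F := ℝ) (fun s ↦ H s (c s)) _ r :=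
    hasMFDerivAt_iff_hasFDerivAt.1 hcomp
  refine hfderiv.hasDerivAt.congr_deriv ((mfderiv_prod_eq_add_apply hH).trans ?_)
  exact congrArg (mvfderiv 𝓘(ℝ, E) (H r) (c r) (L 1) + ·)
    (DFunLike.congr_fun (mfderiv_eq_fderiv (f := fun s ↦ H s (c r))) 1)

variable [IsManifold 𝓘(ℝ, E) ∞ M]

lemma contDiffOn_family_extChartAt_symm
    (hH : ContMDiffOn (𝓘(ℝ, E).prod 𝓘(ℝ, ℝ)) 𝓘(ℝ, ℝ) 1 (fun p : M × ℝ ↦ H p.2 p.1)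
      (univ ×ˢ S)) (x₀ : M) :
    ContDiffOn ℝ 1 (fun q : E × ℝ ↦ H q.2 ((extChartAt 𝓘(ℝ, E) x₀).symm q.1))
      ((extChartAt 𝓘(ℝ, E) x₀).target ×ˢ S) := by
  rw [← contMDiffOn_iff_contDiffOn]
  refine hH.comp (f := fun q : E × ℝ ↦ ((extChartAt 𝓘(ℝ, E) x₀).symm q.1, q.2)) ?_
    fun q hq ↦ ⟨mem_univ _, hq.2⟩
  exact ((contMDiffOn_extChartAt_symm x₀).comp contDiff_fst.contMDiff.contMDiffOn
    fun q hq ↦ hq.1).prodMk contDiff_snd.contMDiff.contMDiffOn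

lemma tendsto_fderiv_family_extChartAt_symm (hS : UniqueDiffOn ℝ S)
    (hH : ContMDiffOn (𝓘(ℝ, E).prod 𝓘(ℝ, ℝ)) 𝓘(ℝ, ℝ) 1 (fun p : M × ℝ ↦ H p.2 p.1)
      (univ ×ˢ S)) (x₀ : M) {r₀ : ℝ} (hr₀ : r₀ ∈ S) :
    Tendsto (fun p : M × ℝ ↦ fderiv ℝ (fun y ↦ H p.2 ((extChartAt 𝓘(ℝ, E) x₀).symm y))
      (extChartAt 𝓘(ℝ, E) x₀ p.1)) (𝓝[univ ×ˢ S] (x₀, r₀))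
      (𝓝 (fderiv ℝ (fun y ↦ H r₀ ((extChartAt 𝓘(ℝ, E) x₀).symm y))
        (extChartAt 𝓘(ℝ, E) x₀ x₀))) :=
  (continuousOn_fderiv_prodMk_left (isOpen_extChartAt_target x₀) hS
    (contDiffOn_family_extChartAt_symm hH x₀) _ ⟨mem_extChartAt_target x₀, hr₀⟩).tendsto.comp
      (tendsto_extChartAt_prod x₀ S)

lemma continuousOn_derivWithin_family (hS : UniqueDiffOn ℝ S)
    (hH : ContMDiffOn (𝓘(ℝ, E).prod 𝓘(ℝ, ℝ)) 𝓘(ℝ, ℝ) 1 (fun p : M × ℝ ↦ H p.2 p.1)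
      (univ ×ˢ S)) :
    ContinuousOn (fun p : M × ℝ ↦ derivWithin (fun s ↦ H s p.1) S p.2) (univ ×ˢ S) := by
  rintro ⟨x₀, r₀⟩ ⟨-, hr₀⟩
  have hchart := (continuousOn_derivWithin_prodMk_right (isOpen_extChartAt_target x₀) hS
    (contDiffOn_family_extChartAt_symm hH x₀) _ ⟨mem_extChartAt_target x₀, hr₀⟩).tendsto.comp
      (tendsto_extChartAt_prod x₀ S)
  have hsource : ∀ᶠ p : M × ℝ in 𝓝[univ ×ˢ S] (x₀, r₀), p.1 ∈ (extChartAt 𝓘(ℝ, E) x₀).source :=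
    nhdsWithin_le_nhds (continuousAt_fst.eventually (extChartAt_source_mem_nhds x₀))
  refine Tendsto.congr' (hsource.mono fun p hp ↦ ?_) (hchart.trans_eq ?_)
  · simp only [Function.comp_apply, (extChartAt 𝓘(ℝ, E) x₀).left_inv hp]
  · simp only [extChartAt_to_inv]

end Families

section ReebMultiplier

variable {E : Type*} [NormedAddCommGroup E] [NormedSpace ℝ E]
variable {M : Type*} [TopologicalSpace M] [ChartedSpace E M]

/-- The Reeb vectors `R` of `lam` on the level set `h⁻¹(0)` at `x` satisfy `d lam (R, ·) = c dh`
with a multiplier `|c| ≤ C`. -/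
def ReebMultiplierBound (lam : OneForm E M) (h : M → ℝ) (x : M) (C : ℝ) : Prop :=
  ∀ R, IsReebVector lam h x R →
    ∃ c : ℝ, |c| ≤ C ∧ ∀ v, lam.extD x R v = c * mvfderiv 𝓘(ℝ, E) h x v

lemma ReebMultiplierBound.mono {lam : OneForm E M} {h : M → ℝ} {x : M} {C C' : ℝ}
    (hC : ReebMultiplierBound lam h x C) (hCC' : C ≤ C') : ReebMultiplierBound lam h x C' :=
  fun R hR ↦ (hC R hR).imp fun _ hc ↦ ⟨hc.1.trans hCC', hc.2⟩

/-- The derivative at `y` of the inverse `φ⁻¹` of the preferred chart around `x₀`, typed as a map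
from the model space to the tangent space at `φ⁻¹ y`. -/
noncomputable def chartSymmDeriv (x₀ : M) (y : E) :
    E →L[ℝ] TangentSpace 𝓘(ℝ, E) ((extChartAt 𝓘(ℝ, E) x₀).symm y) :=
  mfderiv 𝓘(ℝ, E) 𝓘(ℝ, E) (extChartAt 𝓘(ℝ, E) x₀).symm y

variable [IsManifold 𝓘(ℝ, E) ∞ M] {lam : OneForm E M} {h : M → ℝ} {x₀ : M} {y : E}

lemma bijective_chartSymmDeriv (hy : y ∈ (extChartAt 𝓘(ℝ, E) x₀).target) :
    Function.Bijective (chartSymmDeriv x₀ y) := by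
  have hinv := isInvertible_mfderivWithin_extChartAt_symm (I := 𝓘(ℝ, E)) hy
  rw [modelWithCornersSelf_coe, range_id, mfderivWithin_univ] at hinv
  exact hinv.bijective

lemma fderiv_comp_extChartAt_symm (hy : y ∈ (extChartAt 𝓘(ℝ, E) x₀).target)
    (hh : MDifferentiableAt 𝓘(ℝ, E) 𝓘(ℝ, ℝ) h ((extChartAt 𝓘(ℝ, E) x₀).symm y)) (a : E) :
    fderiv ℝ (h ∘ (extChartAt 𝓘(ℝ, E) x₀).symm) y a =
      mvfderiv 𝓘(ℝ, E) h ((extChartAt 𝓘(ℝ, E) x₀).symm y) (chartSymmDeriv x₀ y a) := by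
  have hcomp := mfderiv_comp y hh ((contMDiffAt_extChartAt_symm hy).mdifferentiableAt (by simp))
  rw [mfderiv_eq_fderiv] at hcomp
  exact DFunLike.congr_fun hcomp a

lemma OneForm.IsSmooth.oneFormExtDeriv_inChart (hlam : lam.IsSmooth)
    (hy : y ∈ (extChartAt 𝓘(ℝ, E) x₀).target) (a b : E) :
    oneFormExtDeriv (lam.inChart x₀) y a b =
      lam.extD ((extChartAt 𝓘(ℝ, E) x₀).symm y) (chartSymmDeriv x₀ y a) (chartSymmDeriv x₀ y b) :=
  hlam.oneFormExtDeriv_pullback ((contMDiffAt_extChartAt_symm hy).of_le ENat.LEInfty.out) a b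

lemma fderiv_comp_extChartAt_symm_ne_zero (hy : y ∈ (extChartAt 𝓘(ℝ, E) x₀).target)
    (hh : MDifferentiableAt 𝓘(ℝ, E) 𝓘(ℝ, ℝ) h ((extChartAt 𝓘(ℝ, E) x₀).symm y))
    (hreg : Function.Surjective (mvfderiv 𝓘(ℝ, E) h ((extChartAt 𝓘(ℝ, E) x₀).symm y))) :
    fderiv ℝ (h ∘ (extChartAt 𝓘(ℝ, E) x₀).symm) y ≠ 0 := by
  intro hzero
  obtain ⟨v, hv⟩ := hreg 1
  obtain ⟨a, rfl⟩ := (bijective_chartSymmDeriv hy).2 v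
  rw [← fderiv_comp_extChartAt_symm hy hh, hzero] at hv
  simp at hv

lemma IsContactOnZeroSet.eq_zero_of_inChart (hcontact : IsContactOnZeroSet lam h)
    (hlam : lam.IsSmooth) (hy : y ∈ (extChartAt 𝓘(ℝ, E) x₀).target)
    (hh : MDifferentiableAt 𝓘(ℝ, E) 𝓘(ℝ, ℝ) h ((extChartAt 𝓘(ℝ, E) x₀).symm y))
    (hzero : h ((extChartAt 𝓘(ℝ, E) x₀).symm y) = 0) {a : E}
    (ha : fderiv ℝ (h ∘ (extChartAt 𝓘(ℝ, E) x₀).symm) y a = 0)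
    (hlam_a : lam.inChart x₀ y a = 0)
    (hker : ∀ b, fderiv ℝ (h ∘ (extChartAt 𝓘(ℝ, E) x₀).symm) y b = 0 →
      oneFormExtDeriv (lam.inChart x₀) y a b = 0) : a = 0 := by
  have hbij := bijective_chartSymmDeriv hy
  rw [fderiv_comp_extChartAt_symm hy hh] at ha
  refine hbij.1 (((hcontact _ hzero).2 _ ha hlam_a fun v hv _ ↦ ?_).trans (map_zero _).symm)
  obtain ⟨b, rfl⟩ := hbij.2 v
  rw [← hlam.oneFormExtDeriv_inChart hy]
  exact hker b ((fderiv_comp_extChartAt_symm hy hh b).trans hv)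

lemma ReebMultiplierBound.of_inChart (hlam : lam.IsSmooth)
    (hy : y ∈ (extChartAt 𝓘(ℝ, E) x₀).target)
    (hh : MDifferentiableAt 𝓘(ℝ, E) 𝓘(ℝ, ℝ) h ((extChartAt 𝓘(ℝ, E) x₀).symm y)) {C : ℝ}
    (hC : ∀ a c, lam.inChart x₀ y a = 1 → fderiv ℝ (h ∘ (extChartAt 𝓘(ℝ, E) x₀).symm) y a = 0 →
      oneFormExtDeriv (lam.inChart x₀) y a =
        c • fderiv ℝ (h ∘ (extChartAt 𝓘(ℝ, E) x₀).symm) y → |c| ≤ C) :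
    ReebMultiplierBound lam h ((extChartAt 𝓘(ℝ, E) x₀).symm y) C := by
  intro R hR
  have hsurj := (bijective_chartSymmDeriv hy).2
  obtain ⟨a, rfl⟩ := hsurj R
  have hker : LinearMap.ker (fderiv ℝ (h ∘ (extChartAt 𝓘(ℝ, E) x₀).symm) y).toLinearMap ≤
      LinearMap.ker (oneFormExtDeriv (lam.inChart x₀) y a).toLinearMap := by
    intro b hb
    exact (hlam.oneFormExtDeriv_inChart hy a b).trans
      (hR.kernel _ ((fderiv_comp_extChartAt_symm hy hh b).symm.trans hb))
  obtain ⟨c, hc⟩ := exists_eq_smul_of_ker_le_ker hker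
  have hac : oneFormExtDeriv (lam.inChart x₀) y a =
      c • fderiv ℝ (h ∘ (extChartAt 𝓘(ℝ, E) x₀).symm) y :=
    ContinuousLinearMap.ext fun b ↦ LinearMap.congr_fun hc b
  refine ⟨c, hC a c hR.normalized ((fderiv_comp_extChartAt_symm hy hh a).trans hR.tangent) hac,
    fun v ↦ ?_⟩
  obtain ⟨b, rfl⟩ := hsurj v
  rw [← hlam.oneFormExtDeriv_inChart hy, ← fderiv_comp_extChartAt_symm hy hh, hac]
  rfl

variable [FiniteDimensional ℝ E] {H : ℝ → M → ℝ} {S : Set ℝ}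

lemma exists_eventually_reebMultiplierBound (hlam : lam.IsSmooth) (hS : UniqueDiffOn ℝ S)
    (hH : ContMDiffOn (𝓘(ℝ, E).prod 𝓘(ℝ, ℝ)) 𝓘(ℝ, ℝ) 1 (fun p : M × ℝ ↦ H p.2 p.1)
      (univ ×ˢ S)) {x₀ : M} {r₀ : ℝ} (hr₀ : r₀ ∈ S) (hx₀ : H r₀ x₀ = 0)
    (hreg : ZeroIsRegularValue (E := E) (H r₀)) (hcontact : IsContactOnZeroSet lam (H r₀)) :
    ∃ C : ℝ, ∀ᶠ p : M × ℝ in 𝓝[univ ×ˢ S] (x₀, r₀),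
      ReebMultiplierBound lam (H p.2) p.1 C := by
  have hdiff (x : M) {r : ℝ} (hr : r ∈ S) : MDifferentiableAt 𝓘(ℝ, E) 𝓘(ℝ, ℝ) (H r) x :=
    (contMDiff_of_family hH hr).contMDiffAt.mdifferentiableAt one_ne_zero
  have hy₀ := mem_extChartAt_target (I := 𝓘(ℝ, E)) x₀
  have hsymm₀ := extChartAt_to_inv (I := 𝓘(ℝ, E)) x₀
  have hβ₀ := fderiv_comp_extChartAt_symm_ne_zero hy₀ (hdiff _ hr₀)
    (hreg _ (by rwa [hsymm₀]))
  obtain ⟨C, hC⟩ := exists_eventually_abs_reebMultiplier_le hβ₀ fun u ↦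
    hcontact.eq_zero_of_inChart hlam hy₀ (hdiff _ hr₀) (by rwa [hsymm₀])
  have hφ : Tendsto (fun p : M × ℝ ↦ extChartAt 𝓘(ℝ, E) x₀ p.1) (𝓝[univ ×ˢ S] (x₀, r₀))
      (𝓝 (extChartAt 𝓘(ℝ, E) x₀ x₀)) :=
    ((continuousAt_extChartAt x₀).tendsto.comp continuousAt_fst.tendsto).mono_left
      nhdsWithin_le_nhds
  have hlam₀ := hlam.contDiffAt_inChart x₀
  have htendsto := (hlam₀.continuousAt.tendsto.comp hφ).prodMk_nhds
    ((tendsto_fderiv_family_extChartAt_symm hS hH x₀ hr₀).prodMk_nhds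
      ((continuousAt_oneFormExtDeriv (hlam₀.of_le (by simp))).tendsto.comp hφ))
  have hsource : ∀ᶠ p : M × ℝ in 𝓝[univ ×ˢ S] (x₀, r₀), p.1 ∈ (extChartAt 𝓘(ℝ, E) x₀).source :=
    nhdsWithin_le_nhds (continuousAt_fst.eventually (extChartAt_source_mem_nhds x₀))
  refine ⟨C, ?_⟩
  filter_upwards [htendsto.eventually hC, hsource, self_mem_nhdsWithin] with p hp hpsource hpS
  rw [← (extChartAt 𝓘(ℝ, E) x₀).left_inv hpsource]
  exact .of_inChart hlam ((extChartAt 𝓘(ℝ, E) x₀).map_source hpsource) (hdiff _ hpS.2) hp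

lemma exists_forall_reebMultiplierBound (hlam : lam.IsSmooth) (hS : UniqueDiffOn ℝ S)
    (hH : ContMDiffOn (𝓘(ℝ, E).prod 𝓘(ℝ, ℝ)) 𝓘(ℝ, ℝ) 1 (fun p : M × ℝ ↦ H p.2 p.1)
      (univ ×ˢ S))
    (hreg : ∀ r ∈ S, ZeroIsRegularValue (E := E) (H r))
    (hcontact : ∀ r ∈ S, IsContactOnZeroSet lam (H r))
    (hcomp : IsCompact {p : M × ℝ | p.2 ∈ S ∧ H p.2 p.1 = 0}) :
    ∃ C : ℝ, ∀ r ∈ S, ∀ x, H r x = 0 → ReebMultiplierBound lam (H r) x C := by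
  have hsub : {p : M × ℝ | p.2 ∈ S ∧ H p.2 p.1 = 0} ⊆ univ ×ˢ S := fun p hp ↦ ⟨mem_univ _, hp.1⟩
  obtain ⟨C, hC⟩ := exists_forall_mem_of_isCompact hcomp
    (P := fun p C ↦ ReebMultiplierBound lam (H p.2) p.1 C) (fun _ _ _ ↦ .mono) fun p hp ↦
      (exists_eventually_reebMultiplierBound hlam hS hH hp.1 hp.2 (hreg _ hp.1)
        (hcontact _ hp.1)).imp fun _ hC ↦ nhdsWithin_mono p hsub hC
  exact ⟨C, fun r hr x hx ↦ hC (x, r) ⟨hr, hx⟩⟩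

end ReebMultiplier

namespace IsPeriodicReebFamily

variable {E : Type*} [NormedAddCommGroup E] [NormedSpace ℝ E]
variable {M : Type*} [TopologicalSpace M] [ChartedSpace E M]
variable {lam : OneForm E M} {H : ℝ → M → ℝ} {γ : ℝ → ℝ → M} {τ : ℝ → ℝ} {r : ℝ}

lemma contMDiffAt_uncurry (hγ : IsPeriodicReebFamily lam H γ τ) (hr : r ∈ Ioo (0 : ℝ) 1) (t : ℝ) :
    ContMDiffAt 𝓘(ℝ, ℝ × ℝ) 𝓘(ℝ, E) ∞ (Function.uncurry γ) (r, t) :=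
  hγ.smooth_orbit.contMDiffAt (prod_mem_nhds (Ico_mem_nhds hr.1 hr.2) univ_mem)

lemma mdifferentiableAt_uncurry (hγ : IsPeriodicReebFamily lam H γ τ) (hr : r ∈ Ioo (0 : ℝ) 1)
    (t : ℝ) : MDifferentiableAt 𝓘(ℝ, ℝ × ℝ) 𝓘(ℝ, E) (Function.uncurry γ) (r, t) :=
  (hγ.contMDiffAt_uncurry hr t).mdifferentiableAt (by simp)

lemma apply_eq_zero (hγ : IsPeriodicReebFamily lam H γ τ) (hr : r ∈ Ioo (0 : ℝ) 1) (t : ℝ) :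
    H r (γ r t) = 0 :=
  (hγ.velocity r (Ioo_subset_Ico_self hr) t).elim fun _ hR ↦ hR.1.mem_zeroSet

lemma exists_isReebVector_mfderiv_eq_smul (hγ : IsPeriodicReebFamily lam H γ τ)
    (hr : r ∈ Ioo (0 : ℝ) 1) (t : ℝ) :
    ∃ R, IsReebVector lam (H r) (γ r t) R ∧
      mfderiv 𝓘(ℝ, ℝ × ℝ) 𝓘(ℝ, E) (Function.uncurry γ) (r, t) ((0, 1) : ℝ × ℝ) = τ r • R := by
  obtain ⟨R, hR, hvel⟩ := hγ.velocity r (Ioo_subset_Ico_self hr) t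
  have hslice : HasMFDerivAt 𝓘(ℝ, ℝ) 𝓘(ℝ, E) (γ r) t _ :=
    (hγ.mdifferentiableAt_uncurry hr t).hasMFDerivAt.comp t
      (hasFDerivAt_prodMk_right (𝕜 := ℝ) r t).hasMFDerivAt
  exact ⟨R, hR, (DFunLike.congr_fun (hasMFDerivAt_unique hslice hvel) (1 : ℝ)).trans
    (one_smul ℝ (τ r • R))⟩

lemma pullback_apply_zero_one (hγ : IsPeriodicReebFamily lam H γ τ)
    (hr : r ∈ Ioo (0 : ℝ) 1) (t : ℝ) :
    lam.pullback (Function.uncurry γ) (r, t) (0, 1) = τ r := by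
  obtain ⟨R, hR, hvel⟩ := hγ.exists_isReebVector_mfderiv_eq_smul hr t
  refine (congrArg (lam (γ r t)) hvel).trans ?_
  rw [map_smul, hR.normalized, smul_eq_mul, mul_one]

lemma pullback_periodic (hγ : IsPeriodicReebFamily lam H γ τ) (hr : r ∈ Ioo (0 : ℝ) 1) (t : ℝ) :
    lam.pullback (Function.uncurry γ) (r, t + 1) = lam.pullback (Function.uncurry γ) (r, t) := by
  have hshift : HasFDerivAt (fun q : ℝ × ℝ ↦ q + (0, 1)) (.id ℝ (ℝ × ℝ)) (r, t) :=
    (hasFDerivAt_id _).add_const _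
  have hq : ((r, t) : ℝ × ℝ) + (0, 1) = (r, t + 1) := by simp
  have hperiod : Function.uncurry γ ∘ (fun q : ℝ × ℝ ↦ q + (0, 1)) =ᶠ[𝓝 (r, t)]
      Function.uncurry γ := by
    filter_upwards [continuousAt_fst.eventually (Ioo_mem_nhds hr.1 hr.2)] with q hq
    simpa [Function.uncurry] using hγ.periodic q.1 (Ioo_subset_Ico_self hq) q.2
  have hg : MDifferentiableAt 𝓘(ℝ, ℝ × ℝ) 𝓘(ℝ, E) (Function.uncurry γ) ((r, t) + (0, 1)) := by
    rw [hq]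
    exact hγ.mdifferentiableAt_uncurry hr (t + 1)
  rw [← lam.pullback_congr hperiod, lam.pullback_comp hshift.differentiableAt hg, hshift.fderiv, hq]
  rfl

lemma mvfderiv_mfderiv_one_zero (hγ : IsPeriodicReebFamily lam H γ τ) (hr : r ∈ Ioo (0 : ℝ) 1)
    (t : ℝ) (hH : MDifferentiableAt (𝓘(ℝ, E).prod 𝓘(ℝ, ℝ)) 𝓘(ℝ, ℝ)
      (fun p : M × ℝ ↦ H p.2 p.1) (γ r t, r)) :
    mvfderiv 𝓘(ℝ, E) (H r) (γ r t)
        (mfderiv 𝓘(ℝ, ℝ × ℝ) 𝓘(ℝ, E) (Function.uncurry γ) (r, t) ((1, 0) : ℝ × ℝ)) =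
      -deriv (fun s ↦ H s (γ r t)) r := by
  have hslice : HasMFDerivAt 𝓘(ℝ, ℝ) 𝓘(ℝ, E) (fun s ↦ γ s t) r _ :=
    (hγ.mdifferentiableAt_uncurry hr t).hasMFDerivAt.comp r
      (hasFDerivAt_prodMk_left (𝕜 := ℝ) r t).hasMFDerivAt
  have hzero : (fun s ↦ H s (γ s t)) =ᶠ[𝓝 r] fun _ ↦ 0 := by
    filter_upwards [Ioo_mem_nhds hr.1 hr.2] with s hs using hγ.apply_eq_zero hs t
  exact eq_neg_of_add_eq_zero_left
    ((hasDerivAt_family_comp hH hslice).unique ((hasDerivAt_const r 0).congr_of_eventuallyEq hzero))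

variable [IsManifold 𝓘(ℝ, E) ∞ M]

lemma exists_oneFormExtDeriv_pullback_eq_deriv (hγ : IsPeriodicReebFamily lam H γ τ)
    (hlam : lam.IsSmooth) (hr : r ∈ Ioo (0 : ℝ) 1) :
    ∃ t, oneFormExtDeriv (lam.pullback (Function.uncurry γ)) (r, t) (1, 0) (0, 1) = deriv τ r := by
  refine exists_oneFormExtDeriv_eq_deriv zero_lt_one
    (fun t ↦ hlam.differentiableAt_pullback
      ((hγ.contMDiffAt_uncurry hr t).of_le ENat.LEInfty.out)) (fun t ↦ ?_) ?_
  · filter_upwards [Ioo_mem_nhds hr.1 hr.2] with s hs using hγ.pullback_apply_zero_one hs t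
  · rw [← hγ.pullback_periodic hr 0, zero_add]

lemma abs_deriv_period_le (hγ : IsPeriodicReebFamily lam H γ τ) (hlam : lam.IsSmooth)
    (hr : r ∈ Ioo (0 : ℝ) 1)
    (hH : ∀ t, MDifferentiableAt (𝓘(ℝ, E).prod 𝓘(ℝ, ℝ)) 𝓘(ℝ, ℝ)
      (fun p : M × ℝ ↦ H p.2 p.1) (γ r t, r)) {B C : ℝ}
    (hB : ∀ t, |deriv (fun s ↦ H s (γ r t)) r| ≤ B)
    (hC : ∀ t, ReebMultiplierBound lam (H r) (γ r t) C) :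
    |deriv τ r| ≤ C * B * τ r := by
  obtain ⟨t, ht⟩ := hγ.exists_oneFormExtDeriv_pullback_eq_deriv hlam hr
  obtain ⟨R, hR, hvel⟩ := hγ.exists_isReebVector_mfderiv_eq_smul hr t
  obtain ⟨c, hc, hcd⟩ := hC t R hR
  have hτ := hγ.period_pos r (Ioo_subset_Ico_self hr)
  let w : TangentSpace 𝓘(ℝ, E) (γ r t) :=
    mfderiv 𝓘(ℝ, ℝ × ℝ) 𝓘(ℝ, E) (Function.uncurry γ) (r, t) ((1, 0) : ℝ × ℝ)
  have hderiv : deriv τ r = τ r * (c * deriv (fun s ↦ H s (γ r t)) r) := by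
    calc deriv τ r
        = -oneFormExtDeriv (lam.pullback (Function.uncurry γ)) (r, t) (0, 1) (1, 0) := by
          rw [← ht, oneFormExtDeriv_apply, oneFormExtDeriv_apply, neg_sub]
      _ = -lam.extD (γ r t) (τ r • R) w := by
          rw [← hvel]
          exact congrArg Neg.neg (hlam.oneFormExtDeriv_pullback
            ((hγ.contMDiffAt_uncurry hr t).of_le ENat.LEInfty.out) _ _)
      _ = τ r * (c * -mvfderiv 𝓘(ℝ, E) (H r) (γ r t) w) := by
          rw [lam.extD_smul_left, hcd]
          ring
      _ = τ r * (c * deriv (fun s ↦ H s (γ r t)) r) := by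
          rw [hγ.mvfderiv_mfderiv_one_zero hr t (hH t), neg_neg]
  rw [hderiv, abs_mul, abs_mul, abs_of_pos hτ, mul_comm]
  have hC0 : 0 ≤ C := (abs_nonneg c).trans hc
  gcongr
  exact hB t

end IsPeriodicReebFamily

theorem theorem7p2_general {E : Type*} [NormedAddCommGroup E] [NormedSpace ℝ E]
    [FiniteDimensional ℝ E] {M : Type*} [TopologicalSpace M] [ChartedSpace E M]
    [IsManifold 𝓘(ℝ, E) ∞ M] (lam : OneForm E M) (hlam : lam.IsSmooth) (H : ℝ → M → ℝ)
    (hH : ContMDiffOn (𝓘(ℝ, E).prod 𝓘(ℝ, ℝ)) 𝓘(ℝ, ℝ) 1 (fun p : M × ℝ ↦ H p.2 p.1)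
      (univ ×ˢ Icc (0 : ℝ) 1))
    (hreg : ∀ r ∈ Icc (0 : ℝ) 1, ZeroIsRegularValue (E := E) (H r))
    (hcomp : IsCompact {p : M × ℝ | p.2 ∈ Icc (0 : ℝ) 1 ∧ H p.2 p.1 = 0})
    (hcontact : ∀ r ∈ Icc (0 : ℝ) 1, IsContactOnZeroSet lam (H r))
    (γ : ℝ → ℝ → M) (τ : ℝ → ℝ) (hγ : IsPeriodicReebFamily lam H γ τ) :
    ∃ τ₁ : ℝ, 0 < τ₁ ∧ Tendsto τ (𝓝[<] 1) (𝓝 τ₁) := by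
  have hI := uniqueDiffOn_Icc (zero_lt_one' ℝ)
  obtain ⟨C, hC⟩ := exists_forall_reebMultiplierBound hlam hI hH hreg hcontact hcomp
  obtain ⟨B, hB⟩ := hcomp.exists_bound_of_continuousOn
    ((continuousOn_derivWithin_family hI hH).mono fun p hp ↦ ⟨mem_univ _, hp.1⟩)
  refine exists_tendsto_nhdsLT_of_abs_deriv_le_mul zero_lt_one
    (fun r hr ↦ hγ.period_pos r (Ioo_subset_Ico_self hr))
    (fun r hr ↦ (hγ.smooth_period.contDiffAt (Ico_mem_nhds hr.1 hr.2)).differentiableAt (by simp))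
    fun r hr ↦ hγ.abs_deriv_period_le (B := B) (C := C) hlam hr (fun t ↦ ?_) (fun t ↦ ?_) fun t ↦ ?_
  · exact (hH.contMDiffAt (prod_mem_nhds univ_mem (Icc_mem_nhds hr.1 hr.2))).mdifferentiableAt
      one_ne_zero
  · rw [← derivWithin_of_mem_nhds (Icc_mem_nhds hr.1 hr.2)]
    exact hB (γ r t, r) ⟨Ioo_subset_Icc_self hr, hγ.apply_eq_zero hr t⟩
  · exact hC r (Ioo_subset_Icc_self hr) _ (hγ.apply_eq_zero hr t)

theorem theorem7p2 {E : Type*} [NormedAddCommGroup E] [NormedSpace ℝ E] [FiniteDimensional ℝ E]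
    {M : Type*} [TopologicalSpace M] [T2Space M] [SecondCountableTopology M]
    [ChartedSpace E M] [IsManifold 𝓘(ℝ, E) ∞ M]
    (lam : OneForm E M) (hlam : IsExactSymplectic lam)
    (H : ℝ → M → ℝ)
    (hH : ContMDiffOn (𝓘(ℝ, E).prod 𝓘(ℝ, ℝ)) 𝓘(ℝ, ℝ) ∞ (fun p : M × ℝ ↦ H p.2 p.1)
      (univ ×ˢ Icc (0 : ℝ) 1))
    (hreg : ∀ r ∈ Icc (0 : ℝ) 1, ZeroIsRegularValue (E := E) (H r))
    (hconn : ∀ r ∈ Icc (0 : ℝ) 1, IsConnected {x : M | H r x = 0})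
    (hcomp : IsCompact {p : M × ℝ | p.2 ∈ Icc (0 : ℝ) 1 ∧ H p.2 p.1 = 0})
    (hcontact : ∀ r ∈ Icc (0 : ℝ) 1, IsContactOnZeroSet lam (H r))
    (γ : ℝ → ℝ → M) (τ : ℝ → ℝ) (hγ : IsPeriodicReebFamily lam H γ τ) :
    ∃ τ₁ : ℝ, 0 < τ₁ ∧ Tendsto τ (𝓝[<] 1) (𝓝 τ₁) :=
  theorem7p2_general lam hlam.smooth H (hH.of_le (by simp)) hreg hcomp hcontact γ τ hγ
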